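/- Let $L_2=\mathbb{Z}_2\wr\mathbb{Z}$ be the lamplighter group, i.e. the set of pairs $(\delta,f)$ with $\delta\in\mathbb{Z}$ and $f\colon\mathbb{Z}\to\mathbb{Z}_2$ finitely supported, with multiplication $$(\delta_1,f_1)(\delta_2,f_2)=(\delta_1+\delta_2,\ f_1^{\delta_2}+f_2),\qquad f^{b}(z)=f(z+b).$$ Let $a=(0,\mathbf{1}_0)$ and $t=(1,0)$ be its standard generators, where $\mathbf{1}_0$ takes the value $1$ at $0$ and the value $0$ elsewhere. Let $w=w(a,t,x)$ be an element of the free group $F(a,t,x)$, let $|w|$ be the length of the reduced word representing it, and let $x_w$ be the sum of the exponents of $x$ in $w$. Suppose that $x_w=0$. If the equation $w(a,t,x)=1$ has a solution $x\in L_2$, then it has a solution $x=(\delta,f)\in L_2$ satisfying $$|\delta|\le 2^{|w|^2/2}+2|w|^2+3|w|+1.$$ -/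

import Mathlib

/-- The right action of `ℤ` on finitely supported functions `ℤ → ℤ₂`:
`(shift f b) z = f (z + b)`. -/
def lampShift (f : ℤ →₀ ZMod 2) (b : ℤ) : ℤ →₀ ZMod 2 :=
  Finsupp.equivMapDomain (Equiv.subRight b) f

theorem lampShift_apply (f : ℤ →₀ ZMod 2) (b z : ℤ) : lampShift f b z = f (z + b) := by
  simp [lampShift, Finsupp.equivMapDomain_apply]

/-- The underlying set of the restricted wreath product `ℤ₂ ≀ ℤ` (the lamplighter group):
pairs `(δ, f)` with `δ : ℤ` and `f : ℤ → ℤ₂` finitely supported. -/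
@[ext]
structure Lamplighter where
  /-- The position `δ` of the lamplighter. -/
  pos : ℤ
  /-- The configuration `f` of the lamps. -/
  lamps : ℤ →₀ ZMod 2

namespace Lamplighter

/-- `(δ₁, f₁) (δ₂, f₂) = (δ₁ + δ₂, f₁ ^ δ₂ + f₂)`, where `(f ^ b) z = f (z + b)`. -/
noncomputable instance : Mul Lamplighter :=
  ⟨fun g h => ⟨g.pos + h.pos, lampShift g.lamps h.pos + h.lamps⟩⟩

instance : One Lamplighter := ⟨⟨0, 0⟩⟩

noncomputable instance : Inv Lamplighter := ⟨fun g => ⟨-g.pos, -lampShift g.lamps (-g.pos)⟩⟩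

@[simp] theorem mul_pos (g h : Lamplighter) : (g * h).pos = g.pos + h.pos := rfl

@[simp] theorem mul_lamps (g h : Lamplighter) :
    (g * h).lamps = lampShift g.lamps h.pos + h.lamps := rfl

@[simp] theorem one_pos : (1 : Lamplighter).pos = 0 := rfl

@[simp] theorem one_lamps : (1 : Lamplighter).lamps = 0 := rfl

@[simp] theorem inv_pos (g : Lamplighter) : g⁻¹.pos = -g.pos := rfl

@[simp] theorem inv_lamps (g : Lamplighter) :
    g⁻¹.lamps = -lampShift g.lamps (-g.pos) := rfl

noncomputable instance : Group Lamplighter :=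
  Group.ofLeftAxioms
    (fun g h k => by
      ext z
      · simp [add_assoc]
      · simp only [mul_lamps, mul_pos, Finsupp.add_apply, lampShift_apply]
        rw [add_assoc, add_comm h.pos k.pos, add_assoc])
    (fun g => by
      ext z
      · simp
      · simp [lampShift_apply])
    (fun g => by
      ext z
      · simp
      · simp [lampShift_apply, CharTwo.add_self_eq_zero])

/-- The generator `a = (0, 𝟏₀)`. -/
noncomputable def a : Lamplighter := ⟨0, Finsupp.single 0 1⟩

/-- The generator `t = (1, 0)`. -/
def t : Lamplighter := ⟨1, 0⟩

/-- The alphabet `{a, t, x}`: the constants `a`, `t` and the variable `x`. -/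
inductive Letter
  | a
  | t
  | x
  deriving DecidableEq

/-- The value `w(a, t, s)` in the lamplighter group of the word `w = w(a, t, x)` at `x = s`. -/
noncomputable def eval (s : Lamplighter) : FreeGroup Letter →* Lamplighter :=
  FreeGroup.lift fun
    | Letter.a => Lamplighter.a
    | Letter.t => Lamplighter.t
    | Letter.x => s

/-- The sum `x_w` of the exponents of the variable `x` in `w`. -/
def xExponentSum (w : FreeGroup Letter) : ℤ :=
  Multiplicative.toAdd <|
    FreeGroup.lift (fun l => Multiplicative.ofAdd (if l = Letter.x then (1 : ℤ) else 0)) w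

end Lamplighter

/-! Write n = |w| and read lamp configurations as Laurent polynomials over 𝔽₂. Since `x` and `t`
have exponent sum 0, `w = 1` at (δ, f) is a linear equation `p_δ * f = q_δ`, so δ occurs in a
solution iff `p_δ ∣ q_δ`. With m = |δ| and denominators cleared, this says that P(X, X^m) divides
Q(X, X^m) up to a power of X, for P, Q of degree at most D = 2⌊n/2⌋ in each variable. If m ≤ n(n +
3), the given solution will do. Otherwise m exceeds all degrees in play, and pseudo-dividing Q by P
leaves no remainder (`eq_zero_of_eval_X_pow_dvd`). By Gauss's lemma the primitive part of P divides
Q, say with quotient B, and what remains is that the content h of P divides B(X, X^m) up to a power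
of X. This depends only on m modulo the order of X modulo h (h stripped of powers of X), and that
order is at most 2^D. -/

namespace Polynomial

/-! ### Substituting `X ^ m` for the second variable; pseudo-division. -/

section Bivariate

variable {R : Type*} [CommRing R]

theorem exists_eq_X_pow_mul_not_X_dvd [Nontrivial R] {p : R[X]} (hp : p ≠ 0) :
    ∃ (l : ℕ) (q : R[X]), p = X ^ l * q ∧ ¬ X ∣ q := by
  obtain ⟨q, hq, hd⟩ := exists_eq_pow_rootMultiplicity_mul_and_not_dvd p hp 0
  simp only [map_zero, sub_zero] at hq hd
  exact ⟨_, q, hq, hd⟩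

/-- If the coefficients of `P` have degree less than `m`, then the coefficients of `P(X, X ^ m)` are
those of the coefficients of `P`. -/
theorem coeff_eval_X_pow {P : R[X][X]} {m : ℕ} (hP : ∀ i, (P.coeff i).natDegree < m)
    (i : ℕ) {j : ℕ} (hj : j < m) :
    (P.eval (X ^ m)).coeff (m * i + j) = (P.coeff i).coeff j := by
  have key : ∀ k, (P.coeff k * (X ^ m) ^ k).coeff (m * i + j) =
      if k = i then (P.coeff i).coeff j else 0 := by
    intro k
    rw [← pow_mul, coeff_mul_X_pow']
    -- The k-th term has its exponents in [mk, mk + m), and these blocks are disjoint.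
    rcases lt_trichotomy k i with h | rfl | h
    · have h1 : m * k + m ≤ m * i := by
        calc m * k + m = m * (k + 1) := by ring
          _ ≤ m * i := Nat.mul_le_mul_left _ h
      rw [if_pos (by omega), if_neg h.ne]
      exact coeff_eq_zero_of_natDegree_lt ((hP k).trans_le (by omega))
    · simp
    · have h1 : m * i + m ≤ m * k := by
        calc m * i + m = m * (i + 1) := by ring
          _ ≤ m * k := Nat.mul_le_mul_left _ h
      rw [if_neg (by omega), if_neg h.ne']
  rw [eval_eq_sum_range, finsetSum_coeff, Finset.sum_congr rfl fun k _ => key k,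
    Finset.sum_ite_eq']
  split_ifs with h
  · rfl
  · rw [coeff_eq_zero_of_natDegree_lt (p := P) (by simpa using h), coeff_zero]

theorem eq_zero_of_eval_X_pow_eq_zero {P : R[X][X]} {m : ℕ}
    (hP : ∀ i, (P.coeff i).natDegree < m) (h : P.eval (X ^ m) = 0) : P = 0 := by
  ext i j
  by_cases hj : j < m
  · rw [← coeff_eval_X_pow hP i hj, h]; simp
  · rw [coeff_eq_zero_of_natDegree_lt ((hP i).trans_le (not_lt.mp hj))]; simp

theorem natDegree_eval_X_pow_le {P : R[X][X]} {m D : ℕ} (hP : ∀ i, (P.coeff i).natDegree ≤ D) :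
    (P.eval (X ^ m)).natDegree ≤ m * P.natDegree + D := by
  rw [eval_eq_sum_range]
  refine natDegree_sum_le_of_forall_le _ _ fun k hk => ?_
  rw [← pow_mul]
  refine (natDegree_mul_le_of_le (hP k) (natDegree_X_pow_le _)).trans ?_
  have : m * k ≤ m * P.natDegree := Nat.mul_le_mul_left _ (by simpa [Nat.lt_succ_iff] using hk)
  omega

theorem le_natDegree_eval_X_pow {P : R[X][X]} {m : ℕ} (hP : ∀ i, (P.coeff i).natDegree < m)
    (h0 : P ≠ 0) : m * P.natDegree ≤ (P.eval (X ^ m)).natDegree := by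
  refine le_trans (Nat.le_add_right _ P.leadingCoeff.natDegree) (le_natDegree_of_ne_zero ?_)
  rw [leadingCoeff, coeff_eval_X_pow hP _ (hP _)]
  simpa using h0

/-- Pseudo-division with control of the degrees of the coefficients of the remainder. -/
theorem exists_pseudo_division {P : R[X][X]} {D : ℕ} (hP : ∀ i, (P.coeff i).natDegree ≤ D)
    (h0 : P ≠ 0) : ∀ (e D' : ℕ) (Q : R[X][X]), Q.degree < e →
      (∀ i, (Q.coeff i).natDegree ≤ D') →
      ∃ (j : ℕ) (A S : R[X][X]), C (P.leadingCoeff ^ j) * Q = P * A + S ∧ S.degree < P.degree ∧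
        ∀ i, (S.coeff i).natDegree ≤ D' + e * D := by
  intro e
  induction e with
  | zero =>
    intro D' Q hQ hD
    have hQ0 : Q = 0 := by
      rw [← degree_eq_bot]
      simpa using hQ
    refine ⟨0, 0, 0, by simp [hQ0], ?_, by simp⟩
    rw [degree_zero, bot_lt_iff_ne_bot, Ne, degree_eq_bot]
    exact h0
  | succ e ih =>
    intro D' Q hQ hD
    by_cases hlt : Q.degree < P.degree
    · exact ⟨0, 0, Q, by simp, hlt, fun i => (hD i).trans (by omega)⟩
    have hPe : P.natDegree ≤ e := by
      have h1 : P.degree < (e + 1 : ℕ) := (not_lt.mp hlt).trans_lt hQ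
      rw [degree_eq_natDegree h0] at h1
      exact Nat.lt_succ_iff.mp (by exact_mod_cast h1)
    -- One step cancels the coefficient at `e` and raises coefficient degrees by at most `D`.
    set Q' : R[X][X] := C P.leadingCoeff * Q - P * (C (Q.coeff e) * X ^ (e - P.natDegree)) with hQ'
    have hcoeff : ∀ i, Q'.coeff i = P.leadingCoeff * Q.coeff i -
        if e - P.natDegree ≤ i then P.coeff (i - (e - P.natDegree)) * Q.coeff e else 0 := by
      intro i
      rw [hQ', coeff_sub, coeff_C_mul, ← mul_assoc, coeff_mul_X_pow']
      simp
    have hdeg : Q'.degree < e := by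
      rw [degree_lt_iff_coeff_zero]
      intro i hi
      rw [hcoeff, if_pos (by omega)]
      rcases hi.eq_or_lt with rfl | hi
      · rw [Nat.sub_sub_self hPe, coeff_natDegree, sub_self]
      · rw [coeff_eq_zero_of_degree_lt (p := Q) (hQ.trans_le (by exact_mod_cast hi)),
          coeff_eq_zero_of_natDegree_lt (p := P) (by omega)]
        simp
    have hD' : ∀ i, (Q'.coeff i).natDegree ≤ D' + D := by
      intro i
      rw [hcoeff]
      refine (natDegree_sub_le _ _).trans (max_le ?_ ?_)
      · exact (natDegree_mul_le_of_le (hP _) (hD _)).trans (by omega)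
      · split_ifs
        · exact (natDegree_mul_le_of_le (hP _) (hD _)).trans (by omega)
        · simp
    obtain ⟨j, A, S, h1, h2, h3⟩ := ih _ Q' hdeg hD'
    refine ⟨j + 1, A + C (P.leadingCoeff ^ j) * (C (Q.coeff e) * X ^ (e - P.natDegree)), S, ?_, h2,
      fun i => (h3 i).trans (le_of_eq (by ring))⟩
    have hstep : C (P.leadingCoeff ^ (j + 1)) * Q = C (P.leadingCoeff ^ j) * Q' +
        P * (C (P.leadingCoeff ^ j) * (C (Q.coeff e) * X ^ (e - P.natDegree))) := by
      rw [hQ', pow_succ, C_mul]; ring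
    rw [hstep, h1]; ring

end Bivariate

/-! ### Field coefficients: bounding the exponent m. -/

section Field

variable {K : Type*} [Field K]

theorem isCoprime_X_pow_of_not_X_dvd {p : K[X]} (hp : ¬ X ∣ p) (k : ℕ) : IsCoprime p (X ^ k) :=
  (((prime_X (R := K)).irreducible.coprime_iff_not_dvd).mpr hp).symm.pow_right

/-- If `P(X, X ^ m)` divides `R(X, X ^ m)` up to a power of `X`, where `R` has smaller degree in the
second variable and `m` is large, then `R = 0`. -/
theorem eq_zero_of_eval_X_pow_dvd {P S : K[X][X]} {D F k m : ℕ}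
    (hP : ∀ i, (P.coeff i).natDegree ≤ D) (hX : ¬ X ∣ P)
    (hS : ∀ i, (S.coeff i).natDegree ≤ F) (hdeg : S.degree < P.degree)
    (hm : D + F < m) (hdvd : P.eval (X ^ m) ∣ X ^ k * S.eval (X ^ m)) : S = 0 := by
  have h0 : P ≠ 0 := by rintro rfl; exact hX (dvd_zero _)
  have hPm : ∀ i, (P.coeff i).natDegree < m := fun i => (hP i).trans_lt (by omega)
  have hSm : ∀ i, (S.coeff i).natDegree < m := fun i => (hS i).trans_lt (by omega)
  by_contra hS0
  have hev : P.eval (X ^ m) ≠ 0 := fun h => h0 (eq_zero_of_eval_X_pow_eq_zero hPm h)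
  have hevS : S.eval (X ^ m) ≠ 0 := fun h => hS0 (eq_zero_of_eval_X_pow_eq_zero hSm h)
  obtain ⟨v, q, hq, hXq⟩ := exists_eq_X_pow_mul_not_X_dvd hev
  -- The constant coefficient of `P` is nonzero and fills the lowest block, so the order at X is at
  -- most its degree.
  have hv : v ≤ D := by
    rw [X_dvd_iff] at hX
    refine le_trans ?_ (hP 0)
    by_contra hlt
    have h1 := coeff_eval_X_pow hPm 0 (hPm 0)
    rw [hq, mul_comm, coeff_mul_X_pow', if_neg (by omega), coeff_natDegree] at h1
    exact hX (leadingCoeff_eq_zero.mp h1.symm)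
  have hqS : q ∣ S.eval (X ^ m) :=
    (isCoprime_X_pow_of_not_X_dvd hXq k).dvd_of_dvd_mul_left
      ((Dvd.intro_left (X ^ v) hq.symm).trans hdvd)
  have h1 := natDegree_le_of_dvd hqS hevS
  have h2 := le_natDegree_eval_X_pow hPm h0
  have hq0 : q ≠ 0 := by rintro rfl; exact hXq (dvd_zero _)
  rw [hq, natDegree_mul (pow_ne_zero _ X_ne_zero) hq0, natDegree_X_pow] at h2
  -- Degrees now give m(deg S + 1) ≤ v + deg q ≤ D + m deg S + F, against `hm`.
  have h3 := natDegree_eval_X_pow_le (m := m) hS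
  have h4 : S.natDegree + 1 ≤ P.natDegree := natDegree_lt_natDegree hS0 hdeg
  have h5 : m * (S.natDegree + 1) ≤ m * P.natDegree := Nat.mul_le_mul_left _ h4
  rw [mul_add] at h5
  omega

/-- Gauss's lemma: primitive parts are multiplicative up to units, and that of a constant is a unit.
-/
theorem IsPrimitive.dvd_of_dvd_C_mul {A : Type*} [CommRing A] [IsDomain A]
    [NormalizedGCDMonoid A] {p q : A[X]} (hp : p.IsPrimitive) {c : A} (hc : c ≠ 0)
    (h : p ∣ C c * q) : p ∣ q := by
  by_cases hq : q = 0
  · simp [hq]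
  have h0 : C c * q ≠ 0 := mul_ne_zero (C_ne_zero.mpr hc) hq
  have h1 := (associated_primPart_mul h0).dvd_iff_dvd_right.mp ((hp.dvd_primPart_iff_dvd h0).mpr h)
  exact ((isUnit_primPart_C c).dvd_mul_left.mp h1).trans q.primPart_dvd

/-- Some power `X ^ N` with `0 < N ≤ q ^ deg h` is congruent to `1` modulo `h`, if `h` is prime
to `X`. -/
theorem exists_dvd_X_pow_sub_one [Finite K] {h : K[X]} (hX : ¬ X ∣ h) :
    ∃ N, 0 < N ∧ N ≤ Nat.card K ^ h.natDegree ∧ h ∣ X ^ N - 1 := by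
  have h0 : h ≠ 0 := by rintro rfl; exact hX (dvd_zero _)
  have : Finite (AdjoinRoot h) := by
    have := (AdjoinRoot.powerBasis h0).finite
    exact Module.finite_of_finite K
  have hcard : Nat.card (AdjoinRoot h) = Nat.card K ^ h.natDegree := by
    have := (AdjoinRoot.powerBasis h0).finite
    rw [Module.natCard_eq_pow_finrank (K := K), (AdjoinRoot.powerBasis h0).finrank,
      AdjoinRoot.powerBasis_dim]
  have hunit : IsUnit (AdjoinRoot.mk h X) := by
    obtain ⟨a, b, hab⟩ := isCoprime_X_pow_of_not_X_dvd hX 1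
    refine IsUnit.of_mul_eq_one (AdjoinRoot.mk h b) ?_
    rw [← map_mul, ← map_one (AdjoinRoot.mk h), ← sub_eq_zero, ← map_sub, AdjoinRoot.mk_eq_zero]
    exact ⟨-a, by rw [← hab]; ring⟩
  obtain ⟨u, hu⟩ := hunit
  refine ⟨orderOf u, orderOf_pos u, ?_, ?_⟩
  · rw [← hcard]
    exact (Nat.le_of_dvd Nat.card_pos (orderOf_dvd_natCard u)).trans
      (Nat.card_le_card_of_injective _ Units.val_injective)
  · rw [← AdjoinRoot.mk_eq_zero, map_sub, map_pow, ← hu, ← Units.val_pow_eq_pow_val, pow_orderOf_eq_one]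
    simp

/-- If `P(X, X ^ m)` divides `Q(X, X ^ m)` up to a power of `X` for some large `m`, then the same
holds for some `m` bounded in terms of the degree of the coefficients of `P`. -/
theorem exists_le_eval_X_pow_dvd [Finite K] {P Q : K[X][X]} {D E k m : ℕ}
    (hP : ∀ i, (P.coeff i).natDegree ≤ D) (hQ : ∀ i, (Q.coeff i).natDegree ≤ D)
    (hE : Q.natDegree ≤ E) (hm : (E + 3) * D < m)
    (hdvd : P.eval (X ^ m) ∣ X ^ k * Q.eval (X ^ m)) :
    ∃ m' k', m' ≤ Nat.card K ^ D ∧ P.eval (X ^ m') ∣ X ^ k' * Q.eval (X ^ m') := by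
  classical
  have hDm : D < m := lt_of_le_of_lt (Nat.le_mul_of_pos_left D (by omega)) hm
  by_cases h0 : P = 0
  · subst h0
    have h1 : Q.eval (X ^ m) = 0 := by simpa using hdvd
    have h2 := eq_zero_of_eval_X_pow_eq_zero (fun i => (hQ i).trans_lt hDm) h1
    exact ⟨0, 0, Nat.zero_le _, by simp [h2]⟩
  -- Powers of the second variable in `P` evaluate to powers of X, which are harmless.
  obtain ⟨l, P₀, hl, hXP⟩ := exists_eq_X_pow_mul_not_X_dvd h0
  have hP₀0 : P₀ ≠ 0 := by rintro rfl; exact hXP (dvd_zero _)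
  have hP₀ : ∀ i, (P₀.coeff i).natDegree ≤ D := fun i => by
    have := hP (i + l)
    rwa [hl, coeff_X_pow_mul] at this
  have hPev : ∀ n : ℕ, P.eval (X ^ n) = X ^ (n * l) * P₀.eval (X ^ n) := fun n => by
    rw [hl, eval_mul, eval_pow, eval_X, pow_mul]
  have hdvd₀ : P₀.eval (X ^ m) ∣ X ^ k * Q.eval (X ^ m) := by
    rw [hPev] at hdvd
    exact (Dvd.intro_left _ rfl).trans hdvd
  -- The remainder has coefficients of degree at most D + (E + 1)D; another D from `P₀` gives the
  -- threshold (E + 3)D.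
  obtain ⟨j, A, S, hdiv, hdeg, hS⟩ := exists_pseudo_division hP₀ hP₀0 (E + 1) D Q
    (lt_of_le_of_lt (degree_le_of_natDegree_le hE) (by exact_mod_cast Nat.lt_succ_self E)) hQ
  have hS0 : S = 0 := by
    refine eq_zero_of_eval_X_pow_dvd (k := k) hP₀ hXP hS hdeg
      (lt_of_eq_of_lt (by ring) hm) ?_
    have h1 : S = C (P₀.leadingCoeff ^ j) * Q - P₀ * A := by rw [hdiv]; ring
    rw [h1, eval_sub, eval_mul, eval_mul, eval_C, mul_sub]
    refine dvd_sub ?_ ⟨X ^ k * A.eval (X ^ m), by ring⟩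
    rw [mul_left_comm]
    exact hdvd₀.mul_left _
  rw [hS0, add_zero] at hdiv
  let : NormalizedGCDMonoid K[X] := UniqueFactorizationMonoid.toNormalizedGCDMonoid _
  have hprim := P₀.isPrimitive_primPart
  obtain ⟨B, hB⟩ : P₀.primPart ∣ Q :=
    hprim.dvd_of_dvd_C_mul (pow_ne_zero j (leadingCoeff_ne_zero.mpr hP₀0))
      (P₀.primPart_dvd.trans ⟨A, hdiv⟩)
  have hcont : P₀.content ≠ 0 := content_eq_zero_iff.not.mpr hP₀0
  have hP₀ev : ∀ n : ℕ, P₀.eval (X ^ n) = P₀.content * P₀.primPart.eval (X ^ n) := fun n => by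
    conv_lhs => rw [P₀.eq_C_content_mul_primPart, eval_mul, eval_C]
  have hev0 : P₀.eval (X ^ m) ≠ 0 := fun h =>
    hP₀0 (eq_zero_of_eval_X_pow_eq_zero (fun i => (hP₀ i).trans_lt hDm) h)
  have hprim0 : P₀.primPart.eval (X ^ m) ≠ 0 := fun h => hev0 (by rw [hP₀ev, h, mul_zero])
  obtain ⟨r, h, hr, hXh⟩ := exists_eq_X_pow_mul_not_X_dvd hcont
  have hhB : h ∣ B.eval (X ^ m) := by
    have h1 : P₀.content ∣ X ^ k * B.eval (X ^ m) := by
      refine (mul_dvd_mul_iff_right hprim0).mp ?_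
      rw [← hP₀ev]
      convert hdvd₀ using 1
      rw [hB, eval_mul]; ring
    exact (isCoprime_X_pow_of_not_X_dvd hXh k).dvd_of_dvd_mul_left
      ((Dvd.intro_left _ hr.symm).trans h1)
  have hhD : h.natDegree ≤ D := by
    have hne : P₀.leadingCoeff ≠ 0 := leadingCoeff_ne_zero.mpr hP₀0
    exact (natDegree_le_of_dvd ((Dvd.intro_left _ hr.symm).trans
      (P₀.content_dvd_coeff P₀.natDegree)) hne).trans (hP₀ _)
  obtain ⟨N, hN0, hN, hNdvd⟩ := exists_dvd_X_pow_sub_one hXh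
  -- Modulo `h`, `X ^ m` depends only on m mod N, hence so does the value of `B` there.
  have hmod : h ∣ X ^ m - X ^ (m % N) := by
    have h1 : (X : K[X]) ^ m - X ^ (m % N) = X ^ (m % N) * ((X ^ N) ^ (m / N) - 1 ^ (m / N)) := by
      conv_lhs => rw [← Nat.mod_add_div m N, pow_add, pow_mul]
      simp [mul_sub]
    rw [h1]
    exact (hNdvd.trans (sub_dvd_pow_sub_pow _ _ _)).mul_left _
  have hhB' : h ∣ B.eval (X ^ (m % N)) :=
    (dvd_iff_dvd_of_dvd_sub (hmod.trans (sub_dvd_eval_sub _ _ B))).mp hhB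
  refine ⟨m % N, (m % N) * l + r, ?_, ?_⟩
  · exact (Nat.mod_lt _ hN0).le.trans (hN.trans (Nat.pow_le_pow_right Nat.card_pos hhD))
  · rw [hPev, pow_add, mul_assoc, hP₀ev, hB, eval_mul, hr]
    refine mul_dvd_mul_left _ ?_
    rw [mul_assoc, mul_comm h]
    exact mul_dvd_mul_left _ (mul_dvd_mul_left _ hhB')

end Field

end Polynomial

/-! ### The equation as a divisibility of Laurent polynomials. -/

namespace Lamplighter

open Polynomial LaurentPolynomial

/-- A configuration of lamps as a Laurent polynomial over `ℤ₂`. -/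
noncomputable def lampsToLaurent : (ℤ →₀ ZMod 2) →+ LaurentPolynomial (ZMod 2) where
  toFun f := AddMonoidAlgebra.ofCoeff f
  map_zero' := rfl
  map_add' _ _ := rfl

theorem coeff_lampsToLaurent (f : ℤ →₀ ZMod 2) : (lampsToLaurent f).coeff = f := rfl

theorem lampsToLaurent_eq_zero {f : ℤ →₀ ZMod 2} : lampsToLaurent f = 0 ↔ f = 0 :=
  ⟨fun h => congrArg AddMonoidAlgebra.coeff h, fun h => by rw [h, map_zero]⟩

theorem lampsToLaurent_single (z : ℤ) : lampsToLaurent (Finsupp.single z 1) = T z := rfl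

theorem lampsToLaurent_shift (f : ℤ →₀ ZMod 2) (b : ℤ) :
    lampsToLaurent (lampShift f b) = T (-b) * lampsToLaurent f := by
  ext z
  rw [coeff_lampsToLaurent, lampShift_apply, T,
    AddMonoidAlgebra.coeff_single_mul_eq_mul_coeff (z + b) fun m _ => by omega,
    coeff_lampsToLaurent, one_mul]

theorem neg_lamps (f : ℤ →₀ ZMod 2) : -f = f := by
  ext z
  simp [ZMod.neg_eq_self_mod_two]

/-- The exponent sum of the letter `l` in a word. -/
def letterSum (l : Letter) (L : List (Letter × Bool)) : ℤ :=
  (L.map fun y => if y.1 = l then cond y.2 1 (-1) else 0).sum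

/-- The exponents `(c, e)` of the monomials `T ^ (-c - e δ)` with which the occurrences of the
letter `l` in a word contribute to the lamps of its value at `x = (δ, f)`. -/
def exponents (l : Letter) : List (Letter × Bool) → List (ℤ × ℤ)
  | [] => []
  | y :: L => (if y.1 = l then
      [if l = Letter.x ∧ y.2 = false then
        (letterSum Letter.t L, letterSum Letter.x L - 1)
      else (letterSum Letter.t L, letterSum Letter.x L)] else []) ++ exponents l L

theorem letterSum_cons (l : Letter) (y : Letter × Bool) (L : List (Letter × Bool)) :
    letterSum l (y :: L) = (if y.1 = l then cond y.2 1 (-1) else 0) + letterSum l L := by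
  simp [letterSum]

theorem letterSum_append (l : Letter) (L₁ L₂ : List (Letter × Bool)) :
    letterSum l (L₁ ++ L₂) = letterSum l L₁ + letterSum l L₂ := by
  simp [letterSum]

theorem abs_letterSum_le (l : Letter) (L : List (Letter × Bool)) :
    |letterSum l L| ≤ L.length := by
  induction L with
  | nil => simp [letterSum]
  | cons y L ih =>
    rw [letterSum_cons, List.length_cons]
    refine (abs_add_le _ _).trans ?_
    have : |if y.1 = l then cond y.2 (1 : ℤ) (-1) else 0| ≤ 1 := by
      split_ifs
      · cases y.2 <;> simp
      · simp
    push_cast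
    linarith

/-- For an inverse letter `x⁻¹` the suffix includes the letter itself, whence the `- 1` in
`exponents`. -/
theorem exists_append_of_mem_exponents {l : Letter} {L : List (Letter × Bool)} {p : ℤ × ℤ}
    (hp : p ∈ exponents l L) :
    ∃ L₁ L₂, L = L₁ ++ L₂ ∧ p = (letterSum Letter.t L₂, letterSum Letter.x L₂) := by
  induction L with
  | nil => simp [exponents] at hp
  | cons y L ih =>
    rw [exponents, List.mem_append] at hp
    rcases hp with hp | hp
    · split_ifs at hp with h1 h2
      · refine ⟨[], y :: L, rfl, ?_⟩
        rw [List.mem_singleton] at hp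
        rw [hp, letterSum_cons, letterSum_cons, h1, h2.1, h2.2]
        simp [sub_eq_neg_add]
      · exact ⟨[y], L, rfl, by simpa using hp⟩
      · simp at hp
    · obtain ⟨L₁, L₂, rfl, h⟩ := ih hp
      exact ⟨y :: L₁, L₂, rfl, h⟩

/-- Prefix and suffix sums are opposite, so the shorter piece bounds both. This is why M = ⌊n/2⌋
suffices. -/
theorem two_mul_abs_letterSum_le {l : Letter} {L₁ L₂ : List (Letter × Bool)}
    (h : letterSum l (L₁ ++ L₂) = 0) : 2 * |letterSum l L₂| ≤ (L₁ ++ L₂).length := by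
  rw [letterSum_append] at h
  have h1 := abs_letterSum_le l L₁
  have h2 := abs_letterSum_le l L₂
  rw [eq_neg_of_add_eq_zero_left h, abs_neg] at h1
  rw [List.length_append]
  push_cast
  linarith

/-- The Laurent polynomial `∑ T ^ (-c - e δ)`, the sum being over the occurrences of `l`. -/
noncomputable def letterPoly (l : Letter) (L : List (Letter × Bool)) (δ : ℤ) :
    LaurentPolynomial (ZMod 2) :=
  ((exponents l L).map fun p => T (-(p.1 + p.2 * δ))).sum

theorem eval_mk_cons (s : Lamplighter) (y : Letter × Bool) (L : List (Letter × Bool)) :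
    eval s (FreeGroup.mk (y :: L)) = eval s (FreeGroup.mk [y]) * eval s (FreeGroup.mk L) := by
  rw [← map_mul, FreeGroup.mul_mk, List.singleton_append]

theorem eval_mk_pos (s : Lamplighter) (L : List (Letter × Bool)) :
    (eval s (FreeGroup.mk L)).pos = letterSum Letter.t L + letterSum Letter.x L * s.pos := by
  induction L with
  | nil => simp [eval, letterSum]
  | cons y L ih =>
    rw [eval_mk_cons, mul_pos, ih, letterSum_cons, letterSum_cons]
    rcases y with ⟨_ | _ | _, _ | _⟩ <;> simp [eval, a, t] <;> ring

theorem eval_mk_lamps (s : Lamplighter) (L : List (Letter × Bool)) :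
    lampsToLaurent (eval s (FreeGroup.mk L)).lamps =
      letterPoly Letter.x L s.pos * lampsToLaurent s.lamps + letterPoly Letter.a L s.pos := by
  induction L with
  | nil => simp [eval, letterPoly, exponents]
  | cons y L ih =>
    rw [eval_mk_cons, mul_lamps, map_add, ih, lampsToLaurent_shift, eval_mk_pos]
    rcases y with ⟨_ | _ | _, _ | _⟩ <;>
      simp [eval, a, t, letterPoly, exponents, neg_lamps, lampsToLaurent_single,
        lampsToLaurent_shift, sub_mul, add_mul, ← mul_assoc] <;> ring_nf

theorem eval_mk_eq_one_iff {s : Lamplighter} {L : List (Letter × Bool)}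
    (hx : letterSum Letter.x L = 0) (ht : letterSum Letter.t L = 0) :
    eval s (FreeGroup.mk L) = 1 ↔
      letterPoly Letter.x L s.pos * lampsToLaurent s.lamps = letterPoly Letter.a L s.pos := by
  rw [Lamplighter.ext_iff, eval_mk_pos, hx, ht, one_lamps, ← lampsToLaurent_eq_zero, eval_mk_lamps,
    add_eq_zero_iff_eq_neg,
    show -letterPoly Letter.a L s.pos = letterPoly Letter.a L s.pos from
      congrArg lampsToLaurent (neg_lamps (letterPoly Letter.a L s.pos).coeff)]
  simp

theorem xExponentSum_mk (L : List (Letter × Bool)) :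
    xExponentSum (FreeGroup.mk L) = letterSum Letter.x L := by
  rw [xExponentSum, FreeGroup.lift_mk, letterSum]
  induction L with
  | nil => rfl
  | cons y L ih =>
    rw [List.map_cons, List.prod_cons, toAdd_mul, ih, List.map_cons, List.sum_cons]
    rcases y with ⟨_ | _ | _, _ | _⟩ <;> simp

theorem exists_eval_mk_eq_one_iff {L : List (Letter × Bool)} {δ : ℤ}
    (hx : letterSum Letter.x L = 0) (ht : letterSum Letter.t L = 0) :
    (∃ s : Lamplighter, s.pos = δ ∧ eval s (FreeGroup.mk L) = 1) ↔
      letterPoly Letter.x L δ ∣ letterPoly Letter.a L δ := by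
  constructor
  · rintro ⟨s, rfl, hs⟩
    exact ⟨_, ((eval_mk_eq_one_iff hx ht).mp hs).symm⟩
  · rintro ⟨g, hg⟩
    exact ⟨⟨δ, g.coeff⟩, rfl, (eval_mk_eq_one_iff hx ht).mpr hg.symm⟩

/-! ### Clearing denominators. -/

/-- The polynomial `∑ T ^ (M - c) S ^ (M - ε e)` in `S` and `T`, the sum being over the occurrences
of `l`. -/
noncomputable def letterPoly₂ (l : Letter) (L : List (Letter × Bool)) (M : ℕ) (ε : ℤ) :
    (ZMod 2)[X][X] :=
  ((exponents l L).map fun p =>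
    Polynomial.C (X ^ ((M : ℤ) - p.1).toNat) * X ^ ((M : ℤ) - ε * p.2).toNat).sum

theorem letterPoly₂_bounds {l : Letter} {L : List (Letter × Bool)} {M : ℕ} {ε : ℤ}
    (h₁ : ∀ p ∈ exponents l L, |p.1| ≤ M) (h₂ : ∀ p ∈ exponents l L, |ε * p.2| ≤ M) :
    (letterPoly₂ l L M ε).natDegree ≤ 2 * M ∧
      ∀ i, ((letterPoly₂ l L M ε).coeff i).natDegree ≤ 2 * M := by
  rw [letterPoly₂]
  generalize exponents l L = ps at h₁ h₂
  induction ps with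
  | nil => simp
  | cons p ps ih =>
    obtain ⟨ih₁, ih₂⟩ := ih (fun q hq => h₁ q (List.mem_cons_of_mem _ hq))
      (fun q hq => h₂ q (List.mem_cons_of_mem _ hq))
    have b₁ := abs_le.mp (h₁ p List.mem_cons_self)
    have b₂ := abs_le.mp (h₂ p List.mem_cons_self)
    rw [List.map_cons, List.sum_cons]
    refine ⟨natDegree_add_le_of_degree_le ((natDegree_C_mul_X_pow_le _ _).trans (by omega)) ih₁,
      fun i => ?_⟩
    rw [coeff_add, coeff_C_mul_X_pow]
    refine natDegree_add_le_of_degree_le ?_ (ih₂ i)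
    split_ifs
    · exact (natDegree_X_pow_le _).trans (by omega)
    · simp

theorem toLaurent_eval_letterPoly₂ {l : Letter} {L : List (Letter × Bool)} {M : ℕ} {ε : ℤ}
    (h₁ : ∀ p ∈ exponents l L, |p.1| ≤ M) (h₂ : ∀ p ∈ exponents l L, |ε * p.2| ≤ M) (m : ℕ) :
    toLaurent ((letterPoly₂ l L M ε).eval (X ^ m)) =
      T (M + M * m) * letterPoly l L (ε * m) := by
  rw [letterPoly₂, letterPoly]
  generalize exponents l L = ps at h₁ h₂
  induction ps with
  | nil => simp
  | cons p ps ih =>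
    have b₁ := abs_le.mp (h₁ p List.mem_cons_self)
    have b₂ := abs_le.mp (h₂ p List.mem_cons_self)
    rw [List.map_cons, List.sum_cons, eval_add, map_add, ih
      (fun q hq => h₁ q (List.mem_cons_of_mem _ hq))
      (fun q hq => h₂ q (List.mem_cons_of_mem _ hq)), List.map_cons, List.sum_cons, mul_add,
      eval_mul, eval_C, eval_pow, eval_X, ← pow_mul, ← pow_add, toLaurent_X_pow, ← T_add]
    congr 2
    push_cast
    rw [Int.toNat_of_nonneg (by omega), Int.toNat_of_nonneg (by omega)]
    ring

/-- A Laurent quotient becomes a polynomial after multiplication by a power of T, which is a unit.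
-/
theorem toLaurent_dvd_toLaurent_iff {R : Type*} [CommRing R] {p q : R[X]} :
    toLaurent p ∣ toLaurent q ↔ ∃ k, p ∣ X ^ k * q := by
  constructor
  · rintro ⟨g, hg⟩
    obtain ⟨k, g', hg'⟩ := LaurentPolynomial.exists_T_pow g
    refine ⟨k, g', toLaurent_injective ?_⟩
    rw [map_mul, map_mul, hg', hg, toLaurent_X_pow]
    ring
  · rintro ⟨k, h⟩
    have h1 := map_dvd (toLaurent (R := R)) h
    rw [map_mul, toLaurent_X_pow] at h1
    exact (isUnit_T (R := R) k).dvd_mul_left.mp h1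

theorem letterPoly_dvd_iff {L : List (Letter × Bool)} {M : ℕ} {ε : ℤ}
    (h₁ : ∀ l, ∀ p ∈ exponents l L, |p.1| ≤ M) (h₂ : ∀ l, ∀ p ∈ exponents l L, |ε * p.2| ≤ M)
    (m : ℕ) : letterPoly Letter.x L (ε * m) ∣ letterPoly Letter.a L (ε * m) ↔
      ∃ k, (letterPoly₂ Letter.x L M ε).eval (X ^ m) ∣
        X ^ k * (letterPoly₂ Letter.a L M ε).eval (X ^ m) := by
  rw [← toLaurent_dvd_toLaurent_iff, toLaurent_eval_letterPoly₂ (h₁ _) (h₂ _),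
    toLaurent_eval_letterPoly₂ (h₁ _) (h₂ _), (isUnit_T _).mul_left_dvd,
    (isUnit_T _).dvd_mul_left]

/-! ### The bound on δ. -/

/-- A solvable equation of length `n` in which `x` has exponent sum `0` has a solution `(δ, f)`
with `|δ|` at most `n (n + 3)` or `2 ^ (2 ⌊n / 2⌋)`. -/
theorem exists_eval_eq_one_natAbs_le {w : FreeGroup Letter} (hw : xExponentSum w = 0)
    (hsol : ∃ s : Lamplighter, eval s w = 1) :
    ∃ s : Lamplighter, eval s w = 1 ∧ (s.pos.natAbs ≤ (w.norm + 3) * w.norm ∨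
      s.pos.natAbs ≤ 2 ^ (2 * (w.norm / 2))) := by
  obtain ⟨s, hs⟩ := hsol
  by_cases hsmall : s.pos.natAbs ≤ (w.norm + 3) * w.norm
  · exact ⟨s, hs, .inl hsmall⟩
  set M := w.norm / 2 with hM
  have hlen : w.toWord.length = w.norm := rfl
  obtain ⟨L, hL⟩ : ∃ L, w.toWord = L := ⟨_, rfl⟩
  have hwL : w = FreeGroup.mk L := by rw [← hL, FreeGroup.mk_toWord]
  rw [hL] at hlen
  have hx : letterSum Letter.x L = 0 := by rw [← xExponentSum_mk, ← hwL, hw]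
  -- Compare positions in `w = 1`: the x-part vanishes.
  have ht : letterSum Letter.t L = 0 := by
    have := eval_mk_pos s L
    rw [← hwL, hs, hx] at this
    simpa using this.symm
  have h₁ : ∀ l, ∀ p ∈ exponents l L, |p.1| ≤ M := by
    intro l p hp
    obtain ⟨L₁, L₂, rfl, rfl⟩ := exists_append_of_mem_exponents hp
    have := two_mul_abs_letterSum_le ht
    rw [hlen] at this
    dsimp only
    omega
  have h₂ : ∀ l, ∀ p ∈ exponents l L, |s.pos.sign * p.2| ≤ M := by
    intro l p hp
    obtain ⟨L₁, L₂, rfl, rfl⟩ := exists_append_of_mem_exponents hp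
    have := two_mul_abs_letterSum_le hx
    rw [hlen] at this
    have hp0 : s.pos ≠ 0 := by
      intro h
      simp [h] at hsmall
    rw [abs_mul, Int.abs_sign_of_ne_zero hp0, one_mul]
    dsimp only
    omega
  have hdvd := (exists_eval_mk_eq_one_iff hx ht).mp ⟨s, rfl, hwL ▸ hs⟩
  rw [← Int.sign_mul_natAbs s.pos, letterPoly_dvd_iff h₁ h₂] at hdvd
  obtain ⟨k, hk⟩ := hdvd
  have hP := letterPoly₂_bounds (h₁ Letter.x) (h₂ Letter.x)
  have hQ := letterPoly₂_bounds (h₁ Letter.a) (h₂ Letter.a)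
  -- Here D = E = 2M ≤ n.
  have hm : (2 * M + 3) * (2 * M) < s.pos.natAbs := by
    refine lt_of_le_of_lt (Nat.mul_le_mul ?_ ?_) (not_le.mp hsmall) <;> omega
  obtain ⟨m, k', hm', hk'⟩ := exists_le_eval_X_pow_dvd hP.2 hQ.2 hQ.1 hm hk
  obtain ⟨s', hs', he⟩ := (exists_eval_mk_eq_one_iff hx ht).mpr
    ((letterPoly_dvd_iff h₁ h₂ m).mpr ⟨k', hk'⟩)
  refine ⟨s', hwL ▸ he, .inr ?_⟩
  rw [Nat.card_zmod] at hm'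
  rw [hs', Int.natAbs_mul, Int.natAbs_natCast]
  refine le_trans ?_ hm'
  calc s.pos.sign.natAbs * m ≤ 1 * m := by
        refine Nat.mul_le_mul_right _ ?_
        rw [Int.natAbs_sign]
        split_ifs <;> simp
    _ = m := one_mul m

end Lamplighter

theorem mainTheorem2 (w : FreeGroup Lamplighter.Letter)
    (hw : Lamplighter.xExponentSum w = 0)
    (hsol : ∃ s : Lamplighter, Lamplighter.eval s w = 1) :
    ∃ s : Lamplighter, Lamplighter.eval s w = 1 ∧
      |(s.pos : ℝ)| ≤ (2 : ℝ) ^ ((w.norm : ℝ) ^ 2 / 2)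
        + 2 * (w.norm : ℝ) ^ 2 + 3 * (w.norm : ℝ) + 1 := by
  obtain ⟨s, hs, hbound⟩ := Lamplighter.exists_eval_eq_one_natAbs_le hw hsol
  refine ⟨s, hs, ?_⟩
  have habs : |(s.pos : ℝ)| = (s.pos.natAbs : ℝ) := by
    rw [Nat.cast_natAbs, Int.cast_abs]
  have hpow : (0 : ℝ) ≤ (2 : ℝ) ^ ((w.norm : ℝ) ^ 2 / 2) := by positivity
  have hn : (0 : ℝ) ≤ w.norm := Nat.cast_nonneg _
  rw [habs]
  rcases hbound with h | h
  · have h' : (s.pos.natAbs : ℝ) ≤ (w.norm + 3) * w.norm := by exact_mod_cast h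
    nlinarith
  · have h' : (s.pos.natAbs : ℝ) ≤ (2 : ℝ) ^ (2 * (w.norm / 2)) := by exact_mod_cast h
    -- For n < 2 the left side is 0; otherwise use 2 ≤ n and 2⌊n/2⌋ ≤ n.
    have hexp : ((2 * (w.norm / 2) : ℕ) : ℝ) ≤ (w.norm : ℝ) ^ 2 / 2 := by
      have h2 : 2 * (2 * (w.norm / 2)) ≤ w.norm ^ 2 := by
        rcases Nat.lt_or_ge w.norm 2 with hlt | hge
        · rw [Nat.div_eq_of_lt hlt]; simp
        · calc 2 * (2 * (w.norm / 2)) ≤ w.norm * w.norm := Nat.mul_le_mul hge (by omega)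
            _ = w.norm ^ 2 := (sq _).symm
      have h3 : (2 : ℝ) * ((2 * (w.norm / 2) : ℕ) : ℝ) ≤ (w.norm : ℝ) ^ 2 := by exact_mod_cast h2
      linarith
    have h4 := Real.rpow_le_rpow_of_exponent_le (one_le_two (α := ℝ)) hexp
    rw [Real.rpow_natCast] at h4
    nlinarith
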